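/- Let $\Lambda$ and $\Omega$ be (possibly unbounded) self-adjoint operators on a complex Hilbert space $X$, with domains $D(\Lambda)$, $D(\Omega)$, and suppose that $\Lambda$ is non-negative with zero nullspace. Let $\Lambda^2$ have its natural domain $D(\Lambda^2)=\{f\in D(\Lambda):\Lambda f\in D(\Lambda)\}$, and assume that for some $r>0$ the resolvent $(\Lambda^2+r)^{-1}$ maps $D(\Omega)$ into $D(\Omega)$ (so that commutators of $\Omega$ with functions of $\Lambda^2$ make sense). Suppose that there is a constant $c$ such that $$\|[\Omega,\Lambda^2]f\|\le c\,\|\Lambda f\|\qquad\text{for all } f\in D(\Omega)\cap D(\Lambda^2),$$ where $[\Omega,\Lambda^2]f$ is understood in the weak sense: for every such $f$ there is a vector $h=[\Omega,\Lambda^2]f\in X$ with $\|h\|\le c\|\Lambda f\|$ and $\langle g,h\rangle=\langle\Omega g,\Lambda^2 f\rangle-\langle\Lambda^2 g,\Omega f\rangle$ for all $g\in D(\Omega)\cap D(\Lambda^2)$. Then $[\Omega,\Lambda]$ is bounded on $X$: the operator $\Omega\Lambda-\Lambda\Omega$, on its natural domain $\{f\in D(\Lambda)\cap D(\Omega):\Lambda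 f\in D(\Omega),\ \Omega f\in D(\Lambda)\}$, is densely defined and is the restriction of a bounded operator $T$ on $X$. Moreover $\langle g,Tf\rangle=\langle\Omega g,\Lambda f\rangle-\langle\Lambda g,\Omega f\rangle$ for all $f,g\in D(\Omega)\cap D(\Lambda)$. -/

import Mathlib

open scoped InnerProductSpace

noncomputable section

namespace UnboundedOp

variable {X : Type*} [NormedAddCommGroup X] [InnerProductSpace ℂ X]

/-- The natural domain `{f ∈ D(B) : B f ∈ D(A)}` of the product `A B` of two unbounded
operators. -/
def mulDomain (A B : X →ₗ.[ℂ] X) : Submodule ℂ X :=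
  (A.domain.comap B.toFun).map B.domain.subtype

theorem mem_mulDomain {A B : X →ₗ.[ℂ] X} {f : X} :
    f ∈ mulDomain A B ↔ ∃ h : f ∈ B.domain, B ⟨f, h⟩ ∈ A.domain := by
  unfold mulDomain
  constructor
  · rintro ⟨⟨g, hg⟩, h1, rfl⟩
    exact ⟨hg, h1⟩
  · rintro ⟨h, h1⟩
    exact ⟨⟨f, h⟩, h1, rfl⟩

/-- The product `A B` of two unbounded operators, `f ↦ A (B f)` on its natural domain. -/
def mul (A B : X →ₗ.[ℂ] X) : X →ₗ.[ℂ] X :=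
  A.comp (B.domRestrict (mulDomain A B)) (by
    rintro ⟨f, hf⟩
    obtain ⟨h, h1⟩ := mem_mulDomain.1 hf.1
    exact h1)

theorem mem_mul_domain {A B : X →ₗ.[ℂ] X} {f : X} :
    f ∈ (mul A B).domain ↔ ∃ h : f ∈ B.domain, B ⟨f, h⟩ ∈ A.domain := by
  rw [← mem_mulDomain]
  exact ⟨fun h => h.1, fun h => ⟨h, (mem_mulDomain.1 h).1⟩⟩

theorem mul_apply {A B : X →ₗ.[ℂ] X} (f : (mul A B).domain) (h : (f : X) ∈ B.domain)
    (h1 : B ⟨f, h⟩ ∈ A.domain) : mul A B f = A ⟨B ⟨f, h⟩, h1⟩ := rfl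

/-- The commutator `[A, B] = A B - B A` on its natural domain `D(A B) ∩ D(B A)`. -/
def commutator (A B : X →ₗ.[ℂ] X) : X →ₗ.[ℂ] X := mul A B - mul B A

/-- For symmetric operators `A`, `B` and `f ∈ D(A) ∩ D(B)`: the vector `h` is `[A, B] f` in the
weak (sesquilinear form) sense, that is
`⟪g, h⟫ = ⟪A g, B f⟫ - ⟪B g, A f⟫` for all `g ∈ D(A) ∩ D(B)`. -/
def IsWeakCommutatorAt (A B : X →ₗ.[ℂ] X) (f h : X) : Prop :=
  ∃ (hA : f ∈ A.domain) (hB : f ∈ B.domain),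
    ∀ (g : X) (gA : g ∈ A.domain) (gB : g ∈ B.domain),
      ⟪g, h⟫_ℂ = ⟪A ⟨g, gA⟩, B ⟨f, hB⟩⟫_ℂ - ⟪B ⟨g, gB⟩, A ⟨f, hA⟩⟫_ℂ

end UnboundedOp

end

/-!
For `t > 0` write `J = (1 + t²L²)⁻¹` and `Q = tLJ`. The relative bound makes `[W, J]` a bounded
operator with `‖[W, J] f‖ ≤ ct ‖Q f‖`. For the bounded, strictly positive square root `B` of
`(L² + η²) J` the commutator `C = [W, B]` is then bounded too, and `BC + CB = [W, B²]` satisfies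
`‖(BC + CB) f‖ ≤ c ‖B f‖`. Since `iC` is self-adjoint, a Lyapunov argument turns this
into `‖C‖ ≤ c / 2`, uniformly in `t` and `η`. As `t → 0` and then `η → 0`, `B` tends
strongly to `L` on the domain of `L²`, so the form of `[W, L]` is bounded by `c / 2`.
-/

noncomputable section

namespace UnboundedOp

open Filter Topology ContinuousLinearMap
open scoped ComplexConjugate

variable {X : Type*} [NormedAddCommGroup X] [InnerProductSpace ℂ X]

/-! ### Bounded operators and sesquilinear forms -/

theorem re_inner_apply_self_mono {S T : X →L[ℂ] X} (h : S ≤ T) (x : X) :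
    (⟪S x, x⟫_ℂ).re ≤ (⟪T x, x⟫_ℂ).re := by
  have := ((le_def S T).1 h).re_inner_nonneg_left x
  rwa [sub_apply, inner_sub_left, map_sub, sub_nonneg] at this

theorem mul_norm_sq_le_re_inner_apply_self {B : X →L[ℂ] X} {r : ℝ}
    (h : algebraMap ℝ (X →L[ℂ] X) r ≤ B) (x : X) : r * ‖x‖ ^ 2 ≤ (⟪B x, x⟫_ℂ).re := by
  refine Eq.trans_le ?_ (re_inner_apply_self_mono h x)
  rw [Algebra.algebraMap_eq_smul_one, smul_apply, one_apply_eq_self, inner_smul_left_eq_smul,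
    Complex.real_smul, Complex.re_ofReal_mul, inner_self_eq_norm_sq_to_K]
  norm_cast

section Complete

variable [CompleteSpace X]

theorem isSelfAdjoint_I_smul_commutator {A B : X →L[ℂ] X} (hA : IsSelfAdjoint A)
    (hB : IsSelfAdjoint B) : IsSelfAdjoint (Complex.I • (A * B - B * A)) := by
  rw [IsSelfAdjoint, star_smul, star_sub, star_mul, star_mul, hA.star_eq, hB.star_eq,
    Complex.star_def, Complex.conj_I, neg_smul, ← smul_neg, neg_sub]

theorem exists_pos_algebraMap_le {B : X →L[ℂ] X} (hB : IsStrictlyPositive B) :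
    ∃ ε : ℝ, 0 < ε ∧ algebraMap ℝ (X →L[ℂ] X) ε ≤ B := by
  cases subsingleton_or_nontrivial (X →L[ℂ] X)
  · exact ⟨1, one_pos, (Subsingleton.elim _ _).le⟩
  · exact (CFC.exists_pos_algebraMap_le_iff hB.isSelfAdjoint).2 fun r hr => hB.spectrum_pos hr

theorem nonneg_of_re_inner_nonneg {B P : X →L[ℂ] X} (hB : IsStrictlyPositive B)
    (hP : IsSelfAdjoint P) (h : ∀ x, 0 ≤ (⟪B x, P x⟫_ℂ).re) : 0 ≤ P := by
  refine (StarOrderedRing.nonneg_iff_spectrum_nonneg (R := ℝ) P hP).2 fun r hr => ?_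
  by_contra! hr0
  obtain ⟨ε, hε, hεB⟩ := exists_pos_algebraMap_le hB
  -- For `r < 0` the hypothesis makes the form of `B (P - r)` coercive, so `r ∉ σ(P)`.
  have hunit : IsUnit (B * (P - algebraMap ℝ _ r)) := by
    refine isUnit_of_forall_le_norm_inner_map _ (c := ⟨-r * ε, by nlinarith⟩)
      (show 0 < -r * ε by nlinarith) fun x => ?_
    have hx : (⟪(B * (P - algebraMap ℝ _ r)) x, x⟫_ℂ).re =
        (⟪B x, P x⟫_ℂ).re + -r * (⟪B x, x⟫_ℂ).re := by
      have : ⟪(B * (P - algebraMap ℝ _ r)) x, x⟫_ℂ = ⟪P x - r • x, B x⟫_ℂ :=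
        hB.isSelfAdjoint.isSymmetric _ _
      rw [this, ← inner_conj_symm, Complex.conj_re, inner_sub_right, inner_smul_right_eq_smul,
        Complex.sub_re, Complex.real_smul, Complex.re_ofReal_mul, sub_eq_add_neg, neg_mul]
    calc ‖x‖ ^ 2 * (-r * ε) = -r * (ε * ‖x‖ ^ 2) := by ring
      _ ≤ -r * (⟪B x, x⟫_ℂ).re :=
        mul_le_mul_of_nonneg_left (mul_norm_sq_le_re_inner_apply_self hεB x) (by linarith)
      _ ≤ (⟪(B * (P - algebraMap ℝ _ r)) x, x⟫_ℂ).re := by linarith [h x]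
      _ ≤ _ := Complex.re_le_norm _
  refine spectrum.mem_iff.1 hr ?_
  rw [← neg_sub, IsUnit.neg_iff]
  exact hB.isUnit.mul_left_iff.1 hunit

theorem norm_le_of_le_algebraMap {M : X →L[ℂ] X} (hM : IsSelfAdjoint M) {r : ℝ} (hr : 0 ≤ r)
    (hle : M ≤ algebraMap ℝ _ r) (hneg : -M ≤ algebraMap ℝ _ r) : ‖M‖ ≤ r := by
  cases subsingleton_or_nontrivial (X →L[ℂ] X)
  · simpa [Subsingleton.elim M 0] using hr
  rcases CStarAlgebra.norm_or_neg_norm_mem_spectrum hM with h | h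
  · exact (le_algebraMap_iff_spectrum_le hM).1 hle _ h
  · refine (le_algebraMap_iff_spectrum_le hM.neg).1 hneg _ ?_
    rwa [← spectrum.neg_eq, Set.mem_neg]

theorem anticommutator_le_smul {B M : X →L[ℂ] X} {c : ℝ} (hB : IsStrictlyPositive B)
    (hM : IsSelfAdjoint M) (h : ∀ x, ‖(B * M + M * B) x‖ ≤ c * ‖B x‖) :
    B * M + M * B ≤ c • B := by
  have hBM : IsSelfAdjoint (B * M + M * B) := by
    rw [IsSelfAdjoint, star_add, star_mul, star_mul, hM.star_eq, hB.isSelfAdjoint.star_eq,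
      add_comm]
  rw [← sub_nonneg]
  refine nonneg_of_re_inner_nonneg hB (((IsSelfAdjoint.all c).smul hB.isSelfAdjoint).sub hBM)
    fun x => ?_
  have hcs : (⟪B x, (B * M + M * B) x⟫_ℂ).re ≤ ‖B x‖ * (c * ‖B x‖) :=
    (re_inner_le_norm (𝕜 := ℂ) _ _).trans (by gcongr; exact h x)
  have hself : (⟪B x, (c • B) x⟫_ℂ).re = c * ‖B x‖ ^ 2 := by
    rw [smul_apply, inner_smul_right_eq_smul, Complex.real_smul, Complex.re_ofReal_mul,
      inner_self_eq_norm_sq_to_K]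
    norm_cast
  rw [sub_apply, inner_sub_right, Complex.sub_re, hself]
  linarith

theorem le_algebraMap_of_anticommutator_le {B M : X →L[ℂ] X} {c : ℝ} (hB : IsStrictlyPositive B)
    (hM : IsSelfAdjoint M) (h : B * M + M * B ≤ c • B) : M ≤ algebraMap ℝ _ (c / 2) := by
  rw [← sub_nonneg]
  refine nonneg_of_re_inner_nonneg hB (.sub (.algebraMap _ (.all _)) hM) fun x => ?_
  have hx := re_inner_apply_self_mono h x
  have hBM : ⟪B (M x), x⟫_ℂ = conj ⟪B x, M x⟫_ℂ := by
    rw [inner_conj_symm]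
    exact hB.isSelfAdjoint.isSymmetric (M x) x
  have hMB : ⟪M (B x), x⟫_ℂ = ⟪B x, M x⟫_ℂ := hM.isSymmetric (B x) x
  simp only [add_apply, mul_apply_eq_comp, smul_apply, inner_add_left, hBM, hMB,
    inner_smul_left_eq_smul, Complex.real_smul, Complex.add_re, Complex.conj_re,
    Complex.re_ofReal_mul] at hx
  rw [sub_apply, inner_sub_right, Complex.sub_re, Algebra.algebraMap_eq_smul_one, smul_apply,
    one_apply_eq_self, inner_smul_right_eq_smul, Complex.real_smul, Complex.re_ofReal_mul]
  linarith

theorem norm_le_of_norm_anticommutator_le {B M : X →L[ℂ] X} {c : ℝ}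
    (hB : IsStrictlyPositive B) (hc : 0 ≤ c) (hM : IsSelfAdjoint M)
    (h : ∀ x, ‖(B * M + M * B) x‖ ≤ c * ‖B x‖) : ‖M‖ ≤ c / 2 := by
  refine norm_le_of_le_algebraMap hM (by positivity)
    (le_algebraMap_of_anticommutator_le hB hM (anticommutator_le_smul hB hM h))
    (le_algebraMap_of_anticommutator_le hB hM.neg
      (anticommutator_le_smul hB hM.neg fun x => ?_))
  rw [mul_neg, neg_mul, ← neg_add, neg_apply, norm_neg]
  exact h x

theorem exists_forall_inner_eq_of_bound {D : Submodule ℂ X} (hD : Dense (D : Set X))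
    (φ : D →ₗ⋆[ℂ] D →ₗ[ℂ] ℂ) {d : ℝ} (hφ : ∀ g f, ‖φ g f‖ ≤ d * ‖g‖ * ‖f‖) :
    ∃ T : X →L[ℂ] X, ∀ g f : D, ⟪(g : X), T f⟫_ℂ = φ g f := by
  have hdense : DenseRange D.subtypeL := hD.denseRange_val
  have hind : IsUniformInducing D.subtypeL := isUniformInducing_val _
  let ψ : D →L[ℂ] X →L⋆[ℂ] ℂ := ((φ.mkContinuous₂ d hφ).extend D.subtypeL).flip
  let Φ : X →L⋆[ℂ] X →L[ℂ] ℂ := (ψ.extend D.subtypeL).flip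
  refine ⟨star (InnerProductSpace.continuousLinearMapOfBilin Φ), fun g f => ?_⟩
  calc ⟪(g : X), star (InnerProductSpace.continuousLinearMapOfBilin Φ) f⟫_ℂ
      = Φ g f := by
        rw [star_eq_adjoint, adjoint_inner_right,
          InnerProductSpace.continuousLinearMapOfBilin_apply]
    _ = ψ f g := congrArg (· (g : X)) (ψ.extend_eq hdense hind f)
    _ = φ g f := congrArg (· f) ((φ.mkContinuous₂ d hφ).extend_eq hdense hind g)

end Complete

/-! ### Graphs of unbounded operators -/

section Graph

variable {A B : X →ₗ.[ℂ] X}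

theorem apply_mem_graph {f : X} (hf : f ∈ A.domain) : (f, A ⟨f, hf⟩) ∈ A.graph :=
  A.mem_graph ⟨f, hf⟩

theorem mem_domain_of_mem_graph {f f' : X} (h : (f, f') ∈ A.graph) : f ∈ A.domain :=
  LinearPMap.mem_domain_iff.2 ⟨f', h⟩

theorem apply_eq_of_mem_graph {f f' : X} (h : (f, f') ∈ A.graph) (hf : f ∈ A.domain) :
    A ⟨f, hf⟩ = f' :=
  A.mem_graph_snd_inj' (apply_mem_graph hf) h rfl

theorem mem_graph_mul_iff {f h : X} :
    (f, h) ∈ (mul A B).graph ↔ ∃ f', (f, f') ∈ B.graph ∧ (f', h) ∈ A.graph := by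
  constructor
  · intro hfh
    have hf := mem_domain_of_mem_graph hfh
    obtain ⟨hB, hA⟩ := mem_mul_domain.1 hf
    refine ⟨B ⟨f, hB⟩, apply_mem_graph hB, ?_⟩
    rw [← apply_eq_of_mem_graph hfh hf, mul_apply _ hB hA]
    exact apply_mem_graph hA
  · rintro ⟨f', hB, hA⟩
    have hfB := mem_domain_of_mem_graph hB
    obtain rfl := apply_eq_of_mem_graph hB hfB
    have hfA := mem_domain_of_mem_graph hA
    obtain rfl := apply_eq_of_mem_graph hA hfA
    exact (mul A B).mem_graph ⟨f, mem_mul_domain.2 ⟨hfB, hfA⟩⟩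

theorem sub_mem_graph_commutator {f h k : X} (hAB : (f, h) ∈ (mul A B).graph)
    (hBA : (f, k) ∈ (mul B A).graph) : (f, h - k) ∈ (commutator A B).graph := by
  have hf : f ∈ (commutator A B).domain :=
    ⟨mem_domain_of_mem_graph hAB, mem_domain_of_mem_graph hBA⟩
  convert apply_mem_graph hf
  exact (congrArg₂ (· - ·) (apply_eq_of_mem_graph hAB hf.1)
    (apply_eq_of_mem_graph hBA hf.2)).symm

theorem isWeakCommutatorAt_iff {f h a b : X} (ha : (f, a) ∈ A.graph) (hb : (f, b) ∈ B.graph) :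
    IsWeakCommutatorAt A B f h ↔ ∀ ⦃g a' b'⦄, (g, a') ∈ A.graph → (g, b') ∈ B.graph →
      ⟪g, h⟫_ℂ = ⟪a', b⟫_ℂ - ⟪b', a⟫_ℂ := by
  constructor
  · rintro ⟨hA, hB, hinner⟩ g a' b' ha' hb'
    have := hinner g (mem_domain_of_mem_graph ha') (mem_domain_of_mem_graph hb')
    rwa [apply_eq_of_mem_graph ha, apply_eq_of_mem_graph hb, apply_eq_of_mem_graph ha',
      apply_eq_of_mem_graph hb'] at this
  · intro hinner
    refine ⟨mem_domain_of_mem_graph ha, mem_domain_of_mem_graph hb, fun g gA gB => ?_⟩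
    rw [apply_eq_of_mem_graph ha, apply_eq_of_mem_graph hb]
    exact hinner (apply_mem_graph gA) (apply_mem_graph gB)

variable [CompleteSpace X]

theorem mem_graph_iff_forall_inner (hA : IsSelfAdjoint A) {x y : X} :
    (x, y) ∈ A.graph ↔ ∀ a b, (a, b) ∈ A.graph → ⟪b, x⟫_ℂ = ⟪a, y⟫_ℂ := by
  have h := LinearPMap.adjoint_graph_eq_graph_adjoint hA.dense_domain
  rw [LinearPMap.isSelfAdjoint_def.1 hA] at h
  conv_lhs => rw [h, Submodule.mem_adjoint_iff]
  simp only [sub_eq_zero]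

theorem inner_eq_inner_of_mem_graph (hA : IsSelfAdjoint A) {f f' g g' : X}
    (hf : (f, f') ∈ A.graph) (hg : (g, g') ∈ A.graph) : ⟪g', f⟫_ℂ = ⟪g, f'⟫_ℂ :=
  (mem_graph_iff_forall_inner hA).1 hf g g' hg

theorem eq_of_forall_mem_domain_inner_eq (hA : IsSelfAdjoint A) {x y : X}
    (h : ∀ g ∈ A.domain, ⟪g, x⟫_ℂ = ⟪g, y⟫_ℂ) : x = y :=
  hA.dense_domain.eq_of_inner_right ℂ h

theorem eq_of_forall_mem_domain_apply_eq (hA : IsSelfAdjoint A) {M N : X →L[ℂ] X}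
    (h : ∀ f ∈ A.domain, M f = N f) : M = N :=
  DFunLike.coe_injective (M.continuous.ext_on hA.dense_domain N.continuous h)

end Graph

/-! ### The resolvent of the square -/

section Resolvent

variable {A : X →ₗ.[ℂ] X}

/-- The graph of `t A`, as a subspace of the Hilbert sum `X ⊕ X`. -/
def scaledGraph (A : X →ₗ.[ℂ] X) (t : ℝ) : Submodule ℂ (WithLp 2 (X × X)) :=
  A.graph.comap (((t : ℂ) • WithLp.fstₗ 2 ℂ X X).prod (WithLp.sndₗ 2 ℂ X X))

theorem mem_scaledGraph {t : ℝ} {u v : X} :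
    WithLp.toLp 2 (u, v) ∈ scaledGraph A t ↔ ((t : ℂ) • u, v) ∈ A.graph :=
  Iff.rfl

variable [CompleteSpace X]

theorem smul_mem_graph_iff_forall_inner (hA : IsSelfAdjoint A) {t : ℝ} {u v : X} :
    ((t : ℂ) • u, v) ∈ A.graph ↔
      ∀ a b, ((t : ℂ) • a, b) ∈ A.graph → ⟪b, u⟫_ℂ = ⟪a, v⟫_ℂ := by
  rcases eq_or_ne t 0 with rfl | ht
  · have zero_mem_iff (b : X) : ((0 : X), b) ∈ A.graph ↔ b = 0 :=
      ⟨fun h => A.graph_fst_eq_zero_snd h rfl, by rintro rfl; exact A.graph.zero_mem⟩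
    simp only [Complex.ofReal_zero, zero_smul, zero_mem_iff]
    refine ⟨by rintro rfl a b rfl; simp, fun h => (inner_self_eq_zero (𝕜 := ℂ)).1 ?_⟩
    rw [← h v 0 rfl, inner_zero_left]
  · have ht' : (t : ℂ) ≠ 0 := by exact_mod_cast ht
    rw [mem_graph_iff_forall_inner hA]
    refine ⟨fun h a b hab => ?_, fun h a b hab => ?_⟩
    · simpa [inner_smul_left, inner_smul_right, ht'] using h _ _ hab
    · have := h ((t : ℂ)⁻¹ • a) b (by simpa [smul_smul, ht'] using hab)
      rw [inner_smul_right, this, inner_smul_left, map_inv₀, Complex.conj_ofReal,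
        mul_inv_cancel_left₀ ht']

theorem isClosed_scaledGraph (hA : IsSelfAdjoint A) (t : ℝ) :
    IsClosed (scaledGraph A t : Set (WithLp 2 (X × X))) :=
  hA.isClosed.preimage (f := fun p : WithLp 2 (X × X) => ((t : ℂ) • p.fst, p.snd))
    (((WithLp.fstL 2 ℂ X X).continuous.const_smul _).prodMk (WithLp.sndL 2 ℂ X X).continuous)

theorem hasOrthogonalProjection_scaledGraph (hA : IsSelfAdjoint A) (t : ℝ) :
    (scaledGraph A t).HasOrthogonalProjection :=
  haveI := (isClosed_scaledGraph hA t).completeSpace_coe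
  .ofCompleteSpace _

/-- The map `x ↦ ((1 + t²A²)⁻¹ x, t A (1 + t²A²)⁻¹ x)`, encoded as the orthogonal projection of
`(x, 0)` onto the graph of `t A`. -/
def graphProjection (hA : IsSelfAdjoint A) (t : ℝ) : X →L[ℂ] WithLp 2 (X × X) :=
  haveI := hasOrthogonalProjection_scaledGraph hA t
  (scaledGraph A t).starProjection ∘L
    ((WithLp.prodContinuousLinearEquiv 2 ℂ X X).symm : X × X →L[ℂ] WithLp 2 (X × X)) ∘L
      inl ℂ X X

/-- The normalised resolvent `(1 + t²A²)⁻¹` of the square of a self-adjoint operator `A`. -/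
def sqResolvent (hA : IsSelfAdjoint A) (t : ℝ) : X →L[ℂ] X :=
  WithLp.fstL 2 ℂ X X ∘L graphProjection hA t

/-- The bounded operator `t A (1 + t²A²)⁻¹` attached to a self-adjoint operator `A`. -/
def mulSqResolvent (hA : IsSelfAdjoint A) (t : ℝ) : X →L[ℂ] X :=
  WithLp.sndL 2 ℂ X X ∘L graphProjection hA t

variable (hA : IsSelfAdjoint A) (t : ℝ)

theorem smul_sqResolvent_mem_graph (x : X) :
    ((t : ℂ) • sqResolvent hA t x, mulSqResolvent hA t x) ∈ A.graph :=
  have := hasOrthogonalProjection_scaledGraph hA t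
  (scaledGraph A t).starProjection_apply_mem _

theorem smul_mulSqResolvent_mem_graph (x : X) :
    ((t : ℂ) • mulSqResolvent hA t x, x - sqResolvent hA t x) ∈ A.graph := by
  have := hasOrthogonalProjection_scaledGraph hA t
  refine (smul_mem_graph_iff_forall_inner hA).2 fun a b hab => ?_
  have h := (scaledGraph A t).starProjection_inner_eq_zero (WithLp.toLp 2 (x, 0)) _
    (mem_scaledGraph.2 hab)
  rw [← inner_conj_symm, map_eq_zero] at h
  change ⟪a, x - sqResolvent hA t x⟫_ℂ + ⟪b, 0 - mulSqResolvent hA t x⟫_ℂ = 0 at h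
  rw [zero_sub, inner_neg_right, ← sub_eq_add_neg, sub_eq_zero] at h
  exact h.symm

variable {t}

theorem sqResolvent_mulSqResolvent_eq {u v x : X} (huv : ((t : ℂ) • u, v) ∈ A.graph)
    (hvx : ((t : ℂ) • v, x - u) ∈ A.graph) :
    sqResolvent hA t x = u ∧ mulSqResolvent hA t x = v := by
  have := hasOrthogonalProjection_scaledGraph hA t
  have h : graphProjection hA t x = WithLp.toLp 2 (u, v) := by
    refine Submodule.eq_starProjection_of_mem_of_inner_eq_zero (mem_scaledGraph.2 huv) ?_
    intro w hw
    have := (smul_mem_graph_iff_forall_inner hA).1 hvx w.fst w.snd hw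
    rw [← inner_conj_symm, map_eq_zero]
    change ⟪w.fst, x - u⟫_ℂ + ⟪w.snd, 0 - v⟫_ℂ = 0
    rw [zero_sub, inner_neg_right, this, add_neg_cancel]
  exact ⟨congrArg WithLp.fst h, congrArg WithLp.snd h⟩

theorem mulSqResolvent_eq_of_smul_mem_graph {u v : X} (h : ((t : ℂ) • u, v) ∈ A.graph) :
    mulSqResolvent hA t u = sqResolvent hA t v ∧
      sqResolvent hA t u = u - mulSqResolvent hA t v := by
  refine (sqResolvent_mulSqResolvent_eq hA ?_ ?_).symm
  · have := A.graph.sub_mem h (smul_mulSqResolvent_mem_graph hA t v)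
    simpa only [Prod.mk_sub_mk, ← smul_sub, sub_sub_cancel] using this
  · simpa only [sub_sub_cancel] using smul_sqResolvent_mem_graph hA t v

theorem mulSqResolvent_apply_of_mem_graph {f f' : X} (h : (f, f') ∈ A.graph) :
    mulSqResolvent hA t f = (t : ℂ) • sqResolvent hA t f' := by
  rw [← map_smul]
  exact (mulSqResolvent_eq_of_smul_mem_graph hA (A.graph.smul_mem (t : ℂ) h)).1

theorem sqResolvent_apply_of_mem_graph {f f' : X} (h : (f, f') ∈ A.graph) :
    sqResolvent hA t f = f - (t : ℂ) • mulSqResolvent hA t f' := by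
  rw [← map_smul]
  exact (mulSqResolvent_eq_of_smul_mem_graph hA (A.graph.smul_mem (t : ℂ) h)).2

theorem sqResolvent_mem_graph {f f' : X} (h : (f, f') ∈ A.graph) :
    (sqResolvent hA t f, sqResolvent hA t f') ∈ A.graph := by
  rw [sqResolvent_apply_of_mem_graph hA h]
  simpa only [Prod.mk_sub_mk, sub_sub_cancel] using
    A.graph.sub_mem h (smul_mulSqResolvent_mem_graph hA t f')

theorem mulSqResolvent_sqResolvent_apply (x : X) :
    mulSqResolvent hA t (sqResolvent hA t x) = sqResolvent hA t (mulSqResolvent hA t x) :=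
  (mulSqResolvent_eq_of_smul_mem_graph hA (smul_sqResolvent_mem_graph hA t x)).1

theorem mulSqResolvent_mulSqResolvent_apply (x : X) :
    mulSqResolvent hA t (mulSqResolvent hA t x) =
      sqResolvent hA t x - sqResolvent hA t (sqResolvent hA t x) := by
  rw [(mulSqResolvent_eq_of_smul_mem_graph hA (smul_sqResolvent_mem_graph hA t x)).2,
    sub_sub_cancel]

theorem inner_sqResolvent_left_eq (x y : X) : ⟪sqResolvent hA t x, y⟫_ℂ =
    ⟪sqResolvent hA t x, sqResolvent hA t y⟫_ℂ +
      ⟪mulSqResolvent hA t x, mulSqResolvent hA t y⟫_ℂ := by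
  rw [(smul_mem_graph_iff_forall_inner hA).1 (smul_mulSqResolvent_mem_graph hA t y) _ _
    (smul_sqResolvent_mem_graph hA t x), ← inner_add_right, add_sub_cancel]

theorem inner_sqResolvent_left (x y : X) :
    ⟪sqResolvent hA t x, y⟫_ℂ = ⟪x, sqResolvent hA t y⟫_ℂ := by
  rw [← inner_conj_symm x, inner_sqResolvent_left_eq, inner_sqResolvent_left_eq hA y, map_add,
    inner_conj_symm, inner_conj_symm]

theorem inner_mulSqResolvent_left (x y : X) :
    ⟪mulSqResolvent hA t x, y⟫_ℂ = ⟪x, mulSqResolvent hA t y⟫_ℂ := by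
  have hQ := (smul_mem_graph_iff_forall_inner hA).1 (smul_mulSqResolvent_mem_graph hA t y) _ _
    (smul_mulSqResolvent_mem_graph hA t x)
  have hJ := (smul_mem_graph_iff_forall_inner hA).1 (smul_sqResolvent_mem_graph hA t y) _ _
    (smul_sqResolvent_mem_graph hA t x)
  rw [inner_sub_left, inner_sub_right] at hQ
  linear_combination hJ - hQ

theorem isSelfAdjoint_sqResolvent : IsSelfAdjoint (sqResolvent hA t) :=
  isSelfAdjoint_iff_isSymmetric.2 (inner_sqResolvent_left hA)

theorem isSelfAdjoint_mulSqResolvent : IsSelfAdjoint (mulSqResolvent hA t) :=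
  isSelfAdjoint_iff_isSymmetric.2 (inner_mulSqResolvent_left hA)

theorem commute_mulSqResolvent_sqResolvent :
    Commute (mulSqResolvent hA t) (sqResolvent hA t) :=
  ContinuousLinearMap.ext (mulSqResolvent_sqResolvent_apply hA)

theorem re_inner_sqResolvent_self (x : X) : (⟪sqResolvent hA t x, x⟫_ℂ).re =
    ‖sqResolvent hA t x‖ ^ 2 + ‖mulSqResolvent hA t x‖ ^ 2 := by
  rw [inner_sqResolvent_left_eq, inner_self_eq_norm_sq_to_K, inner_self_eq_norm_sq_to_K]
  norm_cast

theorem sqResolvent_nonneg : 0 ≤ sqResolvent hA t := by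
  refine (nonneg_iff_isPositive _).2
    ((isPositive_def').2 ⟨isSelfAdjoint_sqResolvent hA, fun x => ?_⟩)
  change 0 ≤ (⟪sqResolvent hA t x, x⟫_ℂ).re
  rw [re_inner_sqResolvent_self]
  positivity

theorem norm_sqResolvent_apply_le (x : X) : ‖sqResolvent hA t x‖ ≤ ‖x‖ := by
  have h := re_inner_sqResolvent_self hA (t := t) x
  have := (Complex.re_le_norm _).trans (norm_inner_le_norm (𝕜 := ℂ) (sqResolvent hA t x) x)
  nlinarith [norm_nonneg (sqResolvent hA t x), norm_nonneg x]

theorem norm_mulSqResolvent_apply_le (x : X) : ‖mulSqResolvent hA t x‖ ≤ ‖x‖ := by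
  have h := re_inner_sqResolvent_self hA (t := t) x
  have := (Complex.re_le_norm _).trans (norm_inner_le_norm (𝕜 := ℂ) (sqResolvent hA t x) x)
  nlinarith [norm_nonneg (mulSqResolvent hA t x), norm_nonneg x,
    norm_sqResolvent_apply_le hA (t := t) x]

theorem norm_sub_sqResolvent_apply_le {f f' : X} (h : (f, f') ∈ A.graph) :
    ‖f - sqResolvent hA t f‖ ≤ |t| * ‖f'‖ := by
  rw [sqResolvent_apply_of_mem_graph hA h, sub_sub_cancel, norm_smul, Complex.norm_real,
    Real.norm_eq_abs]
  gcongr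
  exact norm_mulSqResolvent_apply_le hA f'

theorem tendsto_sqResolvent_apply (x : X) :
    Tendsto (fun t : ℝ => sqResolvent hA t x) (𝓝 0) (𝓝 x) := by
  have hclosed : IsClosed {x : X | Tendsto (fun t : ℝ => sqResolvent hA t x) (𝓝 0) (𝓝 x)} := by
    refine Equicontinuous.isClosed_setOfPred_tendsto ?_ continuous_id
    refine (LipschitzWith.uniformEquicontinuous _ 1 fun t => ?_).equicontinuous
    refine LipschitzWith.of_dist_le_mul fun x y => ?_
    simpa [dist_eq_norm, ← map_sub] using norm_sqResolvent_apply_le hA (x - y)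
  refine hclosed.closure_subset_iff.2 (fun f hf => ?_) (hA.dense_domain x)
  refine tendsto_iff_norm_sub_tendsto_zero.2 (squeeze_zero (fun _ => norm_nonneg _)
    (fun t => (norm_sub_rev _ _).trans_le
      (norm_sub_sqResolvent_apply_le hA (apply_mem_graph hf))) ?_)
  exact Continuous.tendsto' (by fun_prop) _ _ (by simp)

theorem one_sub_sqResolvent_eq : 1 - sqResolvent hA t =
    (1 - sqResolvent hA t) * (1 - sqResolvent hA t) +
      mulSqResolvent hA t * mulSqResolvent hA t := by
  have hQQ : mulSqResolvent hA t * mulSqResolvent hA t =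
      sqResolvent hA t - sqResolvent hA t * sqResolvent hA t :=
    ContinuousLinearMap.ext (mulSqResolvent_mulSqResolvent_apply hA)
  rw [hQQ]
  noncomm_ring

theorem mulSqResolvent_mul_self_le :
    mulSqResolvent hA t * mulSqResolvent hA t ≤ 1 - sqResolvent hA t := by
  rw [one_sub_sqResolvent_eq]
  exact le_add_of_nonneg_left
    ((IsSelfAdjoint.one _).sub (isSelfAdjoint_sqResolvent hA)).mul_self_nonneg

theorem one_sub_sqResolvent_nonneg : 0 ≤ 1 - sqResolvent hA t :=
  (isSelfAdjoint_mulSqResolvent hA).mul_self_nonneg.trans (mulSqResolvent_mul_self_le hA)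

theorem inv_smul_mulSqResolvent_mem_graph (ht : t ≠ 0) (x : X) :
    (sqResolvent hA t x, t⁻¹ • mulSqResolvent hA t x) ∈ A.graph := by
  simpa [smul_smul, ht] using
    A.graph.smul_of_tower_mem t⁻¹ (smul_sqResolvent_mem_graph hA t x)

theorem inv_sq_smul_sub_sqResolvent_mem_graph (ht : t ≠ 0) (x : X) :
    (t⁻¹ • mulSqResolvent hA t x, (t ^ 2)⁻¹ • (x - sqResolvent hA t x)) ∈ A.graph := by
  have h := A.graph.smul_of_tower_mem (t ^ 2)⁻¹ (smul_mulSqResolvent_mem_graph hA t x)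
  have hscale : (t ^ 2)⁻¹ * t = t⁻¹ := by field_simp
  rwa [Prod.smul_mk, Complex.coe_smul, smul_smul, hscale] at h

theorem sqResolvent_apply_add_smul_sqResolvent (a t : ℝ) (x : X) :
    sqResolvent hA t (x + (a ^ 2 - 1) • sqResolvent hA (a * t) x) =
      a ^ 2 • sqResolvent hA (a * t) x := by
  refine (sqResolvent_mulSqResolvent_eq hA (v := a • mulSqResolvent hA (a * t) x) ?_ ?_).1
  · have h := A.graph.smul_of_tower_mem a (smul_sqResolvent_mem_graph hA (a * t) x)
    have hscale : a * (a * t) = t * a ^ 2 := by ring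
    rwa [Prod.smul_mk, Complex.coe_smul, smul_smul, hscale, mul_smul, ← Complex.coe_smul t] at h
  · have h := smul_mulSqResolvent_mem_graph hA (a * t) x
    rw [Complex.coe_smul, mul_comm a t, mul_smul, ← Complex.coe_smul t, mul_comm t a] at h
    convert h using 2
    rw [sub_smul, one_smul]
    abel

theorem map_mem_graph_of_commute {S : X →L[ℂ] X} (ht : t ≠ 0)
    (hJ : Commute S (sqResolvent hA t)) (hQ : Commute S (mulSqResolvent hA t)) {f f' : X}
    (h : (f, f') ∈ A.graph) : (S f, S f') ∈ A.graph := by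
  have hSJ (x : X) : S (sqResolvent hA t x) = sqResolvent hA t (S x) := DFunLike.congr_fun hJ x
  have hSQ (x : X) : S (mulSqResolvent hA t x) = mulSqResolvent hA t (S x) :=
    DFunLike.congr_fun hQ x
  have hf : S f = sqResolvent hA t (S f) + (t : ℂ) • mulSqResolvent hA t (S f') := by
    rw [← hSJ, ← hSQ, ← map_smul, ← map_add, sqResolvent_apply_of_mem_graph hA h, sub_add_cancel]
  have hf' : S f' = t⁻¹ • mulSqResolvent hA t (S f) + (S f' - sqResolvent hA t (S f')) := by
    rw [← hSQ, ← hSJ, mulSqResolvent_apply_of_mem_graph hA h, map_smul, Complex.coe_smul,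
      inv_smul_smul₀ ht, add_sub_cancel]
  have hmem := A.graph.add_mem (inv_smul_mulSqResolvent_mem_graph hA ht (S f))
    (smul_mulSqResolvent_mem_graph hA t (S f'))
  rwa [Prod.mk_add_mk, ← hf, ← hf'] at hmem

theorem dense_of_eventually_sqResolvent_mem {D E : Set X} (hD : Dense D)
    (hE : ∀ f ∈ D, ∀ᶠ t in 𝓝[>] 0, sqResolvent hA t f ∈ E) : Dense E := by
  refine dense_closure.1 (hD.mono fun f hf => mem_closure_of_tendsto ?_ (hE f hf))
  exact (tendsto_sqResolvent_apply hA f).mono_left nhdsWithin_le_nhds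

end Resolvent

/-! ### Bounded commutators with bounded operators -/

section BoundedCommutator

/-- `S` maps `D(W)` into itself and `[W, S]` is the restriction of the bounded operator `N`, that
is, `W S f = S W f + N f` for `f ∈ D(W)`. -/
def IsBoundedCommutator (W : X →ₗ.[ℂ] X) (S N : X →L[ℂ] X) : Prop :=
  ∀ ⦃f f' : X⦄, (f, f') ∈ W.graph → (S f, S f' + N f) ∈ W.graph

namespace IsBoundedCommutator

variable {W : X →ₗ.[ℂ] X} {S T M N : X →L[ℂ] X}

theorem mem_domain (hS : IsBoundedCommutator W S N) {f : X} (hf : f ∈ W.domain) :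
    S f ∈ W.domain :=
  mem_domain_of_mem_graph (hS (apply_mem_graph hf))

theorem one : IsBoundedCommutator W 1 0 := fun f f' h => by simpa using h

theorem add (hS : IsBoundedCommutator W S M) (hT : IsBoundedCommutator W T N) :
    IsBoundedCommutator W (S + T) (M + N) := fun f f' h => by
  simpa [add_add_add_comm] using W.graph.add_mem (hS h) (hT h)

theorem smul (a : ℝ) (hS : IsBoundedCommutator W S N) :
    IsBoundedCommutator W (a • S) (a • N) := fun f f' h => by
  simpa using W.graph.smul_of_tower_mem a (hS h)

theorem mul (hS : IsBoundedCommutator W S M) (hT : IsBoundedCommutator W T N) :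
    IsBoundedCommutator W (S * T) (S * N + M * T) := fun f f' h => by
  simpa [add_assoc] using hS (hT h)

variable [CompleteSpace X]

theorem unique (hW : IsSelfAdjoint W) (hM : IsBoundedCommutator W S M)
    (hN : IsBoundedCommutator W S N) : M = N :=
  eq_of_forall_mem_domain_apply_eq hW fun _ hf => add_left_cancel <|
    W.mem_graph_snd_inj' (hM (apply_mem_graph hf)) (hN (apply_mem_graph hf)) rfl

theorem star_eq_neg (hW : IsSelfAdjoint W) (hS : IsSelfAdjoint S)
    (hN : IsBoundedCommutator W S N) : star N = -N := by
  refine eq_of_forall_mem_domain_apply_eq hW fun f hf =>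
    eq_of_forall_mem_domain_inner_eq hW fun g hg => ?_
  have hSf := inner_eq_inner_of_mem_graph hW (hN (apply_mem_graph hf)) (apply_mem_graph hg)
  have hSg := inner_eq_inner_of_mem_graph hW (apply_mem_graph hf) (hN (apply_mem_graph hg))
  have hsymm (x y : X) : ⟪S x, y⟫_ℂ = ⟪x, S y⟫_ℂ := hS.isSymmetric x y
  rw [inner_add_right] at hSf
  rw [inner_add_left, hsymm, hsymm] at hSg
  rw [star_eq_adjoint, adjoint_inner_right, neg_apply, inner_neg_right]
  linear_combination hSg - hSf

theorem exists_of_form_bound (hW : IsSelfAdjoint W) {d : ℝ}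
    (h : ∀ f f' g g', (f, f') ∈ W.graph → (g, g') ∈ W.graph →
      ‖⟪g', S f⟫_ℂ - ⟪g, S f'⟫_ℂ‖ ≤ d * ‖g‖ * ‖f‖) :
    ∃ N, IsBoundedCommutator W S N := by
  let φ : W.domain →ₗ⋆[ℂ] W.domain →ₗ[ℂ] ℂ :=
    ((innerₛₗ ℂ).comp W.toFun).compl₂ (S.toLinearMap ∘ₗ W.domain.subtype) -
      ((innerₛₗ ℂ).comp W.domain.subtype).compl₂ (S.toLinearMap ∘ₗ W.toFun)
  obtain ⟨N, hN⟩ := exists_forall_inner_eq_of_bound hW.dense_domain φ fun g f =>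
    h _ _ _ _ (W.mem_graph f) (W.mem_graph g)
  refine ⟨N, fun f f' hf => (mem_graph_iff_forall_inner hW).2 fun g g' hg => ?_⟩
  obtain ⟨f, rfl, rfl⟩ := W.mem_graph_iff.1 hf
  obtain ⟨g, rfl, rfl⟩ := W.mem_graph_iff.1 hg
  rw [inner_add_right, hN]
  exact (add_sub_cancel _ _).symm

theorem mulSqResolvent_commutator_apply (hW : IsSelfAdjoint W) (t : ℝ)
    (hN : IsBoundedCommutator W S N) (x : X) :
    mulSqResolvent hW t (S x) - S (mulSqResolvent hW t x) =
      (t : ℂ) • (sqResolvent hW t (N (sqResolvent hW t x)) -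
        mulSqResolvent hW t (N (mulSqResolvent hW t x))) := by
  have hJ := hN (smul_sqResolvent_mem_graph hW t x)
  have hQ := hN (smul_mulSqResolvent_mem_graph hW t x)
  rw [map_smul] at hJ hQ
  have hQSJ := (mulSqResolvent_eq_of_smul_mem_graph hW hJ).1
  have hJSQ := (mulSqResolvent_eq_of_smul_mem_graph hW hQ).2
  simp only [map_add, map_sub, map_smul] at hQSJ hJSQ
  rw [hQSJ] at hJSQ
  rw [smul_sub]
  rw [← sub_eq_zero] at hJSQ ⊢
  rw [← hJSQ]
  abel

theorem norm_mulSqResolvent_commutator_le (hW : IsSelfAdjoint W) {t : ℝ} (ht : 0 ≤ t)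
    (hN : IsBoundedCommutator W S N) :
    ‖mulSqResolvent hW t * S - S * mulSqResolvent hW t‖ ≤ 2 * ‖N‖ * t := by
  refine opNorm_le_bound _ (by positivity) fun x => ?_
  have hJ : ‖sqResolvent hW t (N (sqResolvent hW t x))‖ ≤ ‖N‖ * ‖x‖ :=
    (norm_sqResolvent_apply_le hW _).trans
      (N.le_opNorm_of_le (norm_sqResolvent_apply_le hW x))
  have hQ : ‖mulSqResolvent hW t (N (mulSqResolvent hW t x))‖ ≤ ‖N‖ * ‖x‖ :=
    (norm_mulSqResolvent_apply_le hW _).trans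
      (N.le_opNorm_of_le (norm_mulSqResolvent_apply_le hW x))
  rw [sub_apply, mul_apply_eq_comp, mul_apply_eq_comp, mulSqResolvent_commutator_apply hW t hN,
    norm_smul, Complex.norm_of_nonneg ht]
  nlinarith [norm_sub_le (sqResolvent hW t (N (sqResolvent hW t x)))
    (mulSqResolvent hW t (N (mulSqResolvent hW t x)))]

/-- `t⁻¹ • mulSqResolvent hW t` tends to `W` as `t → 0`, so a bound on its commutators with `S`
that is uniform in `t` bounds the commutator with `W`. -/
theorem exists_of_norm_mulSqResolvent_commutator_le (hW : IsSelfAdjoint W) {d : ℝ}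
    (h : ∀ t > 0, ‖mulSqResolvent hW t * S - S * mulSqResolvent hW t‖ ≤ d * t) :
    ∃ N, IsBoundedCommutator W S N := by
  refine exists_of_form_bound hW (d := d) fun f f' g g' hf hg => ?_
  have hJg : Tendsto (fun t => sqResolvent hW t g') (𝓝[>] 0) (𝓝 g') :=
    (tendsto_sqResolvent_apply hW g').mono_left nhdsWithin_le_nhds
  have hJf : Tendsto (fun t => S (sqResolvent hW t f')) (𝓝[>] 0) (𝓝 (S f')) :=
    (S.continuous.tendsto f').comp
      ((tendsto_sqResolvent_apply hW f').mono_left nhdsWithin_le_nhds)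
  have hlim := ((hJg.inner (𝕜 := ℂ) (tendsto_const_nhds (x := S f))).sub
    ((tendsto_const_nhds (x := g)).inner (𝕜 := ℂ) hJf)).norm
  refine le_of_tendsto hlim (eventually_mem_nhdsWithin.mono fun t (ht : 0 < t) => ?_)
  have hform : ⟪g, (mulSqResolvent hW t * S - S * mulSqResolvent hW t) f⟫_ℂ =
      t * (⟪sqResolvent hW t g', S f⟫_ℂ - ⟪g, S (sqResolvent hW t f')⟫_ℂ) := by
    rw [sub_apply, mul_apply_eq_comp, mul_apply_eq_comp, inner_sub_right,
      ← inner_mulSqResolvent_left, mulSqResolvent_apply_of_mem_graph hW hf,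
      mulSqResolvent_apply_of_mem_graph hW hg, map_smul, inner_smul_left, inner_smul_right,
      Complex.conj_ofReal, mul_sub]
  refine le_of_mul_le_mul_left ?_ ht
  calc t * ‖⟪sqResolvent hW t g', S f⟫_ℂ - ⟪g, S (sqResolvent hW t f')⟫_ℂ‖
      = ‖⟪g, (mulSqResolvent hW t * S - S * mulSqResolvent hW t) f⟫_ℂ‖ := by
        rw [hform, norm_mul, Complex.norm_of_nonneg ht.le]
    _ ≤ ‖g‖ * (d * t * ‖f‖) :=
        (norm_inner_le_norm _ _).trans (by gcongr; exact le_of_opNorm_le _ (h t ht) f)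
    _ = t * (d * ‖g‖ * ‖f‖) := by ring

theorem exists_units_inv (hW : IsSelfAdjoint W) (u : (X →L[ℂ] X)ˣ)
    (hN : IsBoundedCommutator W u N) : ∃ M, IsBoundedCommutator W ↑u⁻¹ M := by
  set T : X →L[ℂ] X := ↑u⁻¹ with hT
  refine exists_of_norm_mulSqResolvent_commutator_le hW (d := 2 * ‖N‖ * ‖T‖ ^ 2) fun t ht => ?_
  set Q := mulSqResolvent hW t
  have hconj : Q * T - T * Q = -(T * (Q * u - u * Q) * T) := by
    simp only [hT, mul_sub, sub_mul, mul_assoc, Units.mul_inv, Units.inv_mul_cancel_left, mul_one,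
      neg_sub]
  calc ‖Q * T - T * Q‖ ≤ ‖T‖ * ‖Q * u - u * Q‖ * ‖T‖ := by
        rw [hconj, norm_neg]
        exact (norm_mul_le _ _).trans (by gcongr; exact norm_mul_le _ _)
    _ ≤ ‖T‖ * (2 * ‖N‖ * t) * ‖T‖ := by
        gcongr
        exact norm_mulSqResolvent_commutator_le hW ht.le hN
    _ = 2 * ‖N‖ * ‖T‖ ^ 2 * t := by ring

theorem exists_of_mul_self (hW : IsSelfAdjoint W) (hS : IsStrictlyPositive S)
    (hN : IsBoundedCommutator W (S * S) N) : ∃ M, IsBoundedCommutator W S M := by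
  obtain ⟨u, hu⟩ := hS.isUnit
  set T : X →L[ℂ] X := ↑u⁻¹ with hT
  refine exists_of_norm_mulSqResolvent_commutator_le hW (d := ‖N‖ * ‖T‖) fun t ht => ?_
  have hinv (x : X) : ‖x‖ ≤ ‖T‖ * ‖S x‖ := by
    have hx : T (S x) = x := by
      rw [← hu, ← mul_apply_eq_comp, hT, Units.inv_mul, one_apply_eq_self]
    calc ‖x‖ = ‖T (S x)‖ := by rw [hx]
      _ ≤ ‖T‖ * ‖S x‖ := T.le_opNorm _
  set Q := mulSqResolvent hW t
  set K := Complex.I • (Q * S - S * Q) with hK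
  -- The anticommutator bound for `S` is applied at each fixed `t`, where `K` is bounded.
  have hanti : S * K + K * S = Complex.I • (Q * (S * S) - S * S * Q) := by
    simp only [hK, mul_smul_comm, smul_mul_assoc, ← smul_add]
    congr 1
    noncomm_ring
  have hnorm := norm_le_of_norm_anticommutator_le (c := 2 * ‖N‖ * t * ‖T‖) hS (by positivity)
    (isSelfAdjoint_I_smul_commutator (isSelfAdjoint_mulSqResolvent hW) hS.isSelfAdjoint)
    fun x => by
      calc ‖(S * K + K * S) x‖ ≤ 2 * ‖N‖ * t * ‖x‖ := by
            rw [hanti, smul_apply, norm_smul, Complex.norm_I, one_mul]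
            exact le_of_opNorm_le _ (norm_mulSqResolvent_commutator_le hW ht.le hN) x
        _ ≤ 2 * ‖N‖ * t * (‖T‖ * ‖S x‖) := by gcongr; exact hinv x
        _ = 2 * ‖N‖ * t * ‖T‖ * ‖S x‖ := by ring
  rw [norm_smul, Complex.norm_I, one_mul] at hnorm
  exact hnorm.trans_eq (by ring)

end IsBoundedCommutator

variable {A W : X →ₗ.[ℂ] X} [CompleteSpace X] (hA : IsSelfAdjoint A) {t : ℝ}

theorem IsBoundedCommutator.exists_sqResolvent (hW : IsSelfAdjoint W) {a : ℝ} (ha : 1 ≤ a)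
    {N : X →L[ℂ] X} (hN : IsBoundedCommutator W (sqResolvent hA (a * t)) N) :
    ∃ M, IsBoundedCommutator W (sqResolvent hA t) M := by
  have hpos : IsStrictlyPositive (1 + (a ^ 2 - 1) • sqResolvent hA (a * t)) :=
    isStrictlyPositive_one.add_nonneg
      (smul_nonneg (by nlinarith) (sqResolvent_nonneg hA))
  obtain ⟨u, hu⟩ := hpos.isUnit
  obtain ⟨M, hM⟩ := exists_units_inv hW u (hu ▸ one.add (hN.smul (a ^ 2 - 1)))
  have hJ : sqResolvent hA t * u = a ^ 2 • sqResolvent hA (a * t) :=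
    hu ▸ ContinuousLinearMap.ext (sqResolvent_apply_add_smul_sqResolvent hA a t)
  rw [← u.eq_mul_inv_iff_mul_eq] at hJ
  exact ⟨_, hJ ▸ (hN.smul (a ^ 2)).mul hM⟩

theorem IsBoundedCommutator.norm_inner_sub_inner_le (hW : IsSelfAdjoint W) {S C : X →L[ℂ] X}
    (hS : IsSelfAdjoint S) (hC : IsBoundedCommutator W S C) {d : ℝ} (hd : ‖C‖ ≤ d) {f f' g g' : X}
    (hf : (f, f') ∈ W.graph) (hg : (g, g') ∈ W.graph) :
    ‖⟪g', S f⟫_ℂ - ⟪S g, f'⟫_ℂ‖ ≤ d * ‖g‖ * ‖f‖ := by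
  have hsymm : ⟪S g, f'⟫_ℂ = ⟪g, S f'⟫_ℂ := hS.isSymmetric g f'
  rw [inner_eq_inner_of_mem_graph hW (hC hf) hg, hsymm, ← inner_sub_right, add_sub_cancel_left]
  calc ‖⟪g, C f⟫_ℂ‖ ≤ ‖g‖ * (d * ‖f‖) :=
        (norm_inner_le_norm _ _).trans (by gcongr; exact C.le_of_opNorm_le hd f)
    _ = d * ‖g‖ * ‖f‖ := by ring

end BoundedCommutator

/-! ### Commutators bounded relative to the operator -/

section RelBounded

variable {A W : X →ₗ.[ℂ] X} {c : ℝ}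

/-- The weak commutator `[W, A²]` is bounded relative to `A`, with constant `c`. The vectors
`f'`, `f₁`, `f₂` stand for `W f`, `A f`, `A² f`, and likewise for `g`. -/
def HasRelBoundedSqCommutator (W A : X →ₗ.[ℂ] X) (c : ℝ) : Prop :=
  ∀ ⦃f f' f₁ f₂ : X⦄, (f, f') ∈ W.graph → (f, f₁) ∈ A.graph → (f₁, f₂) ∈ A.graph →
    ∃ h, ‖h‖ ≤ c * ‖f₁‖ ∧ ∀ ⦃g g' g₁ g₂ : X⦄, (g, g') ∈ W.graph → (g, g₁) ∈ A.graph →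
      (g₁, g₂) ∈ A.graph → ⟪g, h⟫_ℂ = ⟪g', f₂⟫_ℂ - ⟪g₂, f'⟫_ℂ

theorem HasRelBoundedSqCommutator.of_isWeakCommutatorAt
    (h : ∀ (f : X) (_ : f ∈ W.domain) (_ : f ∈ (mul A A).domain) (hf : f ∈ A.domain),
      ∃ h : X, IsWeakCommutatorAt W (mul A A) f h ∧ ‖h‖ ≤ c * ‖A ⟨f, hf⟩‖) :
    HasRelBoundedSqCommutator W A |c| := by
  intro f f' f₁ f₂ hf hf₁ hf₂
  have hsq := mem_graph_mul_iff.2 ⟨f₁, hf₁, hf₂⟩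
  obtain ⟨h, hweak, hnorm⟩ := h f (mem_domain_of_mem_graph hf) (mem_domain_of_mem_graph hsq)
    (mem_domain_of_mem_graph hf₁)
  rw [apply_eq_of_mem_graph hf₁] at hnorm
  exact ⟨h, hnorm.trans (by gcongr; exact le_abs_self c), fun g g' g₁ g₂ hg hg₁ hg₂ =>
    (isWeakCommutatorAt_iff hf hsq).1 hweak hg (mem_graph_mul_iff.2 ⟨g₁, hg₁, hg₂⟩)⟩

variable [CompleteSpace X] (hA : IsSelfAdjoint A) {t : ℝ}

theorem sqResolvent_mem_domain_of_resolvent_invariant {r : ℝ} (hr : 0 < r)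
    (hdom : ∀ f : (mul A A).domain, mul A A f + (r : ℂ) • (f : X) ∈ W.domain →
      (f : X) ∈ W.domain) {f : X} (hf : f ∈ W.domain) :
    sqResolvent hA (√r)⁻¹ f ∈ W.domain := by
  have hs : (√r)⁻¹ ≠ 0 := inv_ne_zero (Real.sqrt_ne_zero'.2 hr)
  have hsq := mem_graph_mul_iff.2 ⟨_, inv_smul_mulSqResolvent_mem_graph hA hs f,
    inv_sq_smul_sub_sqResolvent_mem_graph hA hs f⟩
  rw [inv_pow, Real.sq_sqrt hr.le, inv_inv] at hsq
  refine hdom ⟨_, mem_domain_of_mem_graph hsq⟩ ?_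
  rw [apply_eq_of_mem_graph hsq, Complex.coe_smul, ← smul_add, sub_add_cancel]
  exact W.domain.smul_of_tower_mem r hf

theorem HasRelBoundedSqCommutator.exists_sqResolvent_mem_graph (hW : IsSelfAdjoint W)
    (hWA : HasRelBoundedSqCommutator W A c) (ht : 0 < t)
    (hJ : ∀ f ∈ W.domain, sqResolvent hA t f ∈ W.domain) {f f' : X} (hf : (f, f') ∈ W.graph) :
    ∃ k, ‖k‖ ≤ c * t * ‖mulSqResolvent hA t f‖ ∧
      (sqResolvent hA t f, sqResolvent hA t (f' - k)) ∈ W.graph := by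
  have hJf := apply_mem_graph (hJ f (mem_domain_of_mem_graph hf))
  set F := W ⟨sqResolvent hA t f, _⟩
  obtain ⟨h, hnorm, hinner⟩ := hWA hJf (inv_smul_mulSqResolvent_mem_graph hA ht.ne' f)
    (inv_sq_smul_sub_sqResolvent_mem_graph hA ht.ne' f)
  refine ⟨t ^ 2 • h, ?_, ?_⟩
  · rw [norm_smul, norm_inv, Real.norm_of_nonneg ht.le] at hnorm
    calc ‖t ^ 2 • h‖ = t ^ 2 * ‖h‖ := by rw [norm_smul, Real.norm_of_nonneg (by positivity)]
      _ ≤ t ^ 2 * (c * (t⁻¹ * ‖mulSqResolvent hA t f‖)) := by gcongr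
      _ = c * t * ‖mulSqResolvent hA t f‖ := by field_simp
  · suffices F = sqResolvent hA t (f' - t ^ 2 • h) from this ▸ hJf
    refine eq_of_forall_mem_domain_inner_eq hW fun g hg => ?_
    have hJg := apply_mem_graph (hJ g hg)
    set G := W ⟨sqResolvent hA t g, _⟩
    have hweak := hinner hJg (inv_smul_mulSqResolvent_mem_graph hA ht.ne' g)
      (inv_sq_smul_sub_sqResolvent_mem_graph hA ht.ne' g)
    have hsymm : ⟪G, sqResolvent hA t f⟫_ℂ = ⟪sqResolvent hA t g, F⟫_ℂ :=
      inner_eq_inner_of_mem_graph hW hJf hJg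
    have hsymm' : ⟪G, f⟫_ℂ = ⟪sqResolvent hA t g, f'⟫_ℂ := inner_eq_inner_of_mem_graph hW hf hJg
    have hscaled : (t : ℂ) ^ 2 * ⟪sqResolvent hA t g, h⟫_ℂ = ⟪G, f⟫_ℂ - ⟪g, F⟫_ℂ := by
      have ht' : (t : ℂ) ≠ 0 := by exact_mod_cast ht.ne'
      rw [hweak, inner_smul_left_eq_smul, inner_smul_right_eq_smul, inner_sub_left,
        inner_sub_right, hsymm, Complex.real_smul, Complex.real_smul]
      push_cast
      field_simp
      ring
    rw [← inner_sqResolvent_left, inner_sub_right, inner_smul_right_eq_smul, Complex.real_smul]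
    push_cast
    rw [hscaled, hsymm']
    ring

theorem HasRelBoundedSqCommutator.exists_isBoundedCommutator (hW : IsSelfAdjoint W)
    (hWA : HasRelBoundedSqCommutator W A c) (hc : 0 ≤ c) (ht : 0 < t)
    (hJ : ∀ f ∈ W.domain, sqResolvent hA t f ∈ W.domain) :
    ∃ N, IsBoundedCommutator W (sqResolvent hA t) N := by
  refine IsBoundedCommutator.exists_of_form_bound hW (d := c * t) fun f f' g g' hf hg => ?_
  obtain ⟨k, hk, hJf⟩ := hWA.exists_sqResolvent_mem_graph hA hW ht hJ hf
  rw [inner_eq_inner_of_mem_graph hW hJf hg, ← inner_sub_right, ← map_sub, sub_sub_cancel_left]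
  calc ‖⟪g, sqResolvent hA t (-k)⟫_ℂ‖ ≤ ‖g‖ * ‖k‖ :=
        (norm_inner_le_norm _ _).trans <| by
          gcongr
          exact (norm_sqResolvent_apply_le hA _).trans_eq (norm_neg k)
    _ ≤ ‖g‖ * (c * t * ‖f‖) := by
        gcongr
        exact hk.trans (by gcongr; exact norm_mulSqResolvent_apply_le hA f)
    _ = c * t * ‖g‖ * ‖f‖ := by ring

theorem HasRelBoundedSqCommutator.norm_commutator_sqResolvent_apply_le (hW : IsSelfAdjoint W)
    (hWA : HasRelBoundedSqCommutator W A c) (ht : 0 < t) {N : X →L[ℂ] X}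
    (hN : IsBoundedCommutator W (sqResolvent hA t) N) (x : X) :
    ‖N x‖ ≤ c * t * ‖mulSqResolvent hA t x‖ := by
  have hclosed : IsClosed {x | ‖N x‖ ≤ c * t * ‖mulSqResolvent hA t x‖} :=
    isClosed_le (by fun_prop) (by fun_prop)
  refine hclosed.closure_subset_iff.2 (fun f hf => ?_) (hW.dense_domain x)
  obtain ⟨k, hk, hJf⟩ := hWA.exists_sqResolvent_mem_graph hA hW ht
    (fun _ => hN.mem_domain) (apply_mem_graph hf)
  have hNf := W.mem_graph_snd_inj' (hN (apply_mem_graph hf)) hJf rfl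
  rw [map_sub, sub_eq_add_neg, add_right_inj] at hNf
  calc ‖N f‖ ≤ ‖k‖ := by rw [hNf, norm_neg]; exact norm_sqResolvent_apply_le hA k
    _ ≤ _ := hk

theorem HasRelBoundedSqCommutator.eventually_exists_isBoundedCommutator (hW : IsSelfAdjoint W)
    (hWA : HasRelBoundedSqCommutator W A c) (hc : 0 ≤ c) {s : ℝ} (hs : 0 < s)
    (hJ : ∀ f ∈ W.domain, sqResolvent hA s f ∈ W.domain) :
    ∀ᶠ t in 𝓝[>] 0, ∃ N, IsBoundedCommutator W (sqResolvent hA t) N := by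
  obtain ⟨N, hN⟩ := hWA.exists_isBoundedCommutator hA hW hc hs hJ
  filter_upwards [Ioc_mem_nhdsGT hs] with t ⟨ht, hts⟩
  refine IsBoundedCommutator.exists_sqResolvent hA hW (a := s / t) ((one_le_div₀ ht).2 hts)
    (N := N) ?_
  rwa [div_mul_cancel₀ _ ht.ne']

end RelBounded

/-! ### Bounded approximations of the absolute value -/

section Regularized

variable [CompleteSpace X] {A W : X →ₗ.[ℂ] X} (hA : IsSelfAdjoint A) {t η c : ℝ}

/-- The bounded operator `(A² + η²) (1 + t²A²)⁻¹`, written so that the unbounded `A²` does not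
occur: `A² (1 + t²A²)⁻¹ = t⁻² (1 - (1 + t²A²)⁻¹)`. Meaningful only for `t ≠ 0`. -/
def regularizedSq (t η : ℝ) : X →L[ℂ] X :=
  (t ^ 2)⁻¹ • (1 - sqResolvent hA t) + η ^ 2 • sqResolvent hA t

/-- The positive square root of `regularizedSq`, a bounded approximation of `|A|` for small `t`
and `η`. -/
def regularizedAbs (t η : ℝ) : X →L[ℂ] X :=
  CFC.sqrt (regularizedSq hA t η)

theorem sq_le_inv_sq_of_mul_sq_le_one (ht : 0 < t) (hηt : (η * t) ^ 2 ≤ 1) :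
    η ^ 2 ≤ (t ^ 2)⁻¹ := by
  rwa [← one_div, le_div_iff₀ (by positivity), ← mul_pow]

theorem algebraMap_sq_le_regularizedSq (ht : 0 < t) (hηt : (η * t) ^ 2 ≤ 1) :
    algebraMap ℝ (X →L[ℂ] X) (η ^ 2) ≤ regularizedSq hA t η := by
  have hη := sq_le_inv_sq_of_mul_sq_le_one ht hηt
  rw [← sub_nonneg, Algebra.algebraMap_eq_smul_one, regularizedSq]
  convert smul_nonneg (sub_nonneg.2 hη) (one_sub_sqResolvent_nonneg hA (t := t)) using 1
  module

theorem regularizedSq_nonneg (t η : ℝ) : 0 ≤ regularizedSq hA t η :=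
  add_nonneg (smul_nonneg (by positivity) (one_sub_sqResolvent_nonneg hA))
    (smul_nonneg (by positivity) (sqResolvent_nonneg hA))

theorem regularizedAbs_mul_self (t η : ℝ) :
    regularizedAbs hA t η * regularizedAbs hA t η = regularizedSq hA t η :=
  CFC.sqrt_mul_sqrt_self _ (regularizedSq_nonneg hA t η)

theorem isSelfAdjoint_regularizedAbs (t η : ℝ) : IsSelfAdjoint (regularizedAbs hA t η) :=
  (CFC.sqrt_nonneg _).isSelfAdjoint

theorem algebraMap_le_regularizedAbs (ht : 0 < t) (hη : 0 ≤ η) (hηt : (η * t) ^ 2 ≤ 1) :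
    algebraMap ℝ (X →L[ℂ] X) η ≤ regularizedAbs hA t η := by
  rw [← CFC.sqrt_sq (algebraMap ℝ (X →L[ℂ] X) η) (algebraMap_nonneg _ hη), ← map_pow]
  exact CFC.sqrt_le_sqrt _ _ (algebraMap_sq_le_regularizedSq hA ht hηt)

theorem isStrictlyPositive_regularizedAbs (ht : 0 < t) (hη : 0 < η) (hηt : (η * t) ^ 2 ≤ 1) :
    IsStrictlyPositive (regularizedAbs hA t η) :=
  (isStrictlyPositive_algebraMap hη).of_le (algebraMap_le_regularizedAbs hA ht hη.le hηt)

theorem commute_regularizedAbs {S : X →L[ℂ] X} (hS : Commute S (sqResolvent hA t)) :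
    Commute (regularizedAbs hA t η) S := by
  rw [regularizedAbs, CFC.sqrt_eq_cfc]
  exact Commute.cfc_nnreal ((((Commute.one_right S).sub_right hS).smul_right _).add_right
    (hS.smul_right _)).symm _

theorem norm_mulSqResolvent_apply_le_regularizedAbs (ht : 0 < t) (η : ℝ) (x : X) :
    ‖mulSqResolvent hA t x‖ ≤ t * ‖regularizedAbs hA t η x‖ := by
  have norm_sq {S : X →L[ℂ] X} (hS : IsSelfAdjoint S) :
      ‖S x‖ ^ 2 = (⟪(S * S) x, x⟫_ℂ).re := by
    have hinner : ⟪(S * S) x, x⟫_ℂ = ⟪S x, S x⟫_ℂ := hS.isSymmetric (S x) x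
    rw [hinner, inner_self_eq_norm_sq_to_K]
    norm_cast
  have hle : mulSqResolvent hA t * mulSqResolvent hA t ≤ t ^ 2 • regularizedSq hA t η := by
    refine (mulSqResolvent_mul_self_le hA).trans ?_
    rw [regularizedSq, smul_add, smul_inv_smul₀ (by positivity)]
    exact le_add_of_nonneg_right
      (smul_nonneg (by positivity) (smul_nonneg (by positivity) (sqResolvent_nonneg hA)))
  refine le_of_sq_le_sq ?_ (by positivity)
  calc ‖mulSqResolvent hA t x‖ ^ 2
      ≤ (⟪(t ^ 2 • regularizedSq hA t η) x, x⟫_ℂ).re := by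
        rw [norm_sq (isSelfAdjoint_mulSqResolvent hA)]
        exact re_inner_apply_self_mono hle x
    _ = (t * ‖regularizedAbs hA t η x‖) ^ 2 := by
        rw [smul_apply, inner_smul_left_eq_smul, Complex.real_smul, Complex.re_ofReal_mul,
          mul_pow, norm_sq (isSelfAdjoint_regularizedAbs hA t η), regularizedAbs_mul_self]

theorem regularizedSq_apply_of_mem_graph (ht : t ≠ 0) {f f₁ f₂ : X} (hf : (f, f₁) ∈ A.graph)
    (hf₁ : (f₁, f₂) ∈ A.graph) : regularizedSq hA t η f =
      sqResolvent hA t f₂ + η ^ 2 • sqResolvent hA t f := by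
  have hsub : f - sqResolvent hA t f = t ^ 2 • sqResolvent hA t f₂ := by
    rw [sqResolvent_apply_of_mem_graph hA hf, sub_sub_cancel,
      mulSqResolvent_apply_of_mem_graph hA hf₁, Complex.coe_smul, Complex.coe_smul,
      smul_smul, sq]
  change (t ^ 2)⁻¹ • (f - sqResolvent hA t f) + η ^ 2 • sqResolvent hA t f = _
  rw [hsub, inv_smul_smul₀ (by positivity)]

theorem mul_norm_regularizedAbs_sub_le (hA_nonneg : ∀ f : A.domain, 0 ≤ (⟪(f : X), A f⟫_ℂ).re)
    (ht : 0 < t) (hη : 0 ≤ η) (hηt : (η * t) ^ 2 ≤ 1) {f f₁ f₂ : X} (hf : (f, f₁) ∈ A.graph)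
    (hf₁ : (f₁, f₂) ∈ A.graph) :
    η * ‖regularizedAbs hA t η f - f₁‖ ≤ η ^ 2 * ‖f‖ + ‖f₂ - sqResolvent hA t f₂‖ := by
  set B := regularizedAbs hA t η
  set h := B f - f₁
  -- `h` solves `(B + A) h = B² f - A² f`, and `B + A` is bounded below by `η`.
  have hh : (h, B f₁ - f₂) ∈ A.graph :=
    A.graph.sub_mem (map_mem_graph_of_commute hA ht.ne' (commute_regularizedAbs hA (.refl _))
      (commute_regularizedAbs hA (commute_mulSqResolvent_sqResolvent hA)) hf) hf₁
  have hsum : B h + (B f₁ - f₂) = η ^ 2 • sqResolvent hA t f - (f₂ - sqResolvent hA t f₂) := by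
    have hBB : B (B f) = _ := DFunLike.congr_fun (regularizedAbs_mul_self hA t η) f
    rw [map_sub, hBB, regularizedSq_apply_of_mem_graph hA ht.ne' hf hf₁]
    abel
  have hpos : 0 ≤ (⟪h, B f₁ - f₂⟫_ℂ).re := by
    simpa only [apply_eq_of_mem_graph hh] using hA_nonneg ⟨h, mem_domain_of_mem_graph hh⟩
  have hcoercive : η * ‖h‖ ^ 2 ≤ (⟪h, B h⟫_ℂ).re := by
    rw [← inner_conj_symm, Complex.conj_re]
    exact mul_norm_sq_le_re_inner_apply_self (algebraMap_le_regularizedAbs hA ht hη hηt) h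
  have hmul : η * ‖h‖ * ‖h‖ ≤ (η ^ 2 * ‖f‖ + ‖f₂ - sqResolvent hA t f₂‖) * ‖h‖ := by
    calc η * ‖h‖ * ‖h‖ ≤ (⟪h, B h + (B f₁ - f₂)⟫_ℂ).re := by
          rw [inner_add_right, Complex.add_re]
          linarith
      _ ≤ ‖h‖ * ‖η ^ 2 • sqResolvent hA t f - (f₂ - sqResolvent hA t f₂)‖ :=
          hsum ▸ re_inner_le_norm (𝕜 := ℂ) _ _
      _ ≤ ‖h‖ * (η ^ 2 * ‖f‖ + ‖f₂ - sqResolvent hA t f₂‖) := by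
          refine mul_le_mul_of_nonneg_left ((norm_sub_le _ _).trans ?_) (norm_nonneg h)
          rw [norm_smul, Real.norm_of_nonneg (by positivity)]
          gcongr
          exact norm_sqResolvent_apply_le hA f
      _ = _ := mul_comm _ _
  rcases eq_or_lt_of_le (norm_nonneg h) with h0 | h0
  · rw [← h0, mul_zero]
    positivity
  · exact le_of_mul_le_mul_right hmul h0

theorem eventually_mul_sq_le_one (η : ℝ) : ∀ᶠ t : ℝ in 𝓝[>] 0, (η * t) ^ 2 ≤ 1 :=
  have hlim : Tendsto (fun t : ℝ => (η * t) ^ 2) (𝓝 0) (𝓝 0) :=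
    Continuous.tendsto' (by fun_prop) _ _ (by simp)
  nhdsWithin_le_nhds (hlim.eventually_le_const one_pos)

theorem eventually_norm_regularizedAbs_sub_le
    (hA_nonneg : ∀ f : A.domain, 0 ≤ (⟪(f : X), A f⟫_ℂ).re) (hη : 0 < η) {f f₁ f₂ : X}
    (hf : (f, f₁) ∈ A.graph) (hf₁ : (f₁, f₂) ∈ A.graph) :
    ∀ᶠ t in 𝓝[>] 0, ‖regularizedAbs hA t η f - f₁‖ ≤ η * (‖f‖ + 1) := by
  have hlim := tendsto_iff_norm_sub_tendsto_zero.1 (tendsto_sqResolvent_apply hA f₂)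
  filter_upwards [eventually_mem_nhdsWithin, eventually_mul_sq_le_one η,
    nhdsWithin_le_nhds (hlim.eventually_le_const (sq_pos_of_pos hη))] with t ht hηt hclose
  refine le_of_mul_le_mul_left ((mul_norm_regularizedAbs_sub_le hA hA_nonneg ht hη.le hηt hf
    hf₁).trans ?_) hη
  rw [norm_sub_rev]
  linarith

theorem HasRelBoundedSqCommutator.exists_isBoundedCommutator_regularizedAbs
    (hW : IsSelfAdjoint W) (hWA : HasRelBoundedSqCommutator W A c) (hc : 0 ≤ c) (ht : 0 < t)
    (hη : 0 < η) (hηt : (η * t) ^ 2 ≤ 1) {N : X →L[ℂ] X}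
    (hN : IsBoundedCommutator W (sqResolvent hA t) N) :
    ∃ C, IsBoundedCommutator W (regularizedAbs hA t η) C ∧ ‖C‖ ≤ c / 2 := by
  set B := regularizedAbs hA t η with hB
  have hBpos : IsStrictlyPositive B := isStrictlyPositive_regularizedAbs hA ht hη hηt
  have hη' := sq_le_inv_sq_of_mul_sq_le_one ht hηt
  have hBB : IsBoundedCommutator W (B * B) ((η ^ 2 - (t ^ 2)⁻¹) • N) := by
    have h := (IsBoundedCommutator.one (W := W)).smul (t ^ 2)⁻¹ |>.add
      (hN.smul (η ^ 2 - (t ^ 2)⁻¹))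
    rw [hB, regularizedAbs_mul_self, regularizedSq]
    convert h using 1 <;> module
  obtain ⟨C, hC⟩ := IsBoundedCommutator.exists_of_mul_self hW hBpos hBB
  refine ⟨C, hC, ?_⟩
  have hanti : B * C + C * B = (η ^ 2 - (t ^ 2)⁻¹) • N := (hC.mul hC).unique hW hBB
  have hIC : IsSelfAdjoint (Complex.I • C) := by
    rw [IsSelfAdjoint, star_smul, hC.star_eq_neg hW hBpos.isSelfAdjoint, Complex.star_def,
      Complex.conj_I, neg_smul_neg]
  have hbound (x : X) : ‖(B * C + C * B) x‖ ≤ c * ‖B x‖ := by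
    rw [hanti, smul_apply, norm_smul, Real.norm_of_nonpos (sub_nonpos.2 hη'), neg_sub]
    calc ((t ^ 2)⁻¹ - η ^ 2) * ‖N x‖ ≤ (t ^ 2)⁻¹ * (c * t * (t * ‖B x‖)) := by
          gcongr
          · exact sub_le_self _ (sq_nonneg η)
          · exact (hWA.norm_commutator_sqResolvent_apply_le hA hW ht hN x).trans
              (by gcongr; exact norm_mulSqResolvent_apply_le_regularizedAbs hA ht η x)
      _ = c * ‖B x‖ := by field_simp
  have hnorm := norm_le_of_norm_anticommutator_le hBpos hc hIC fun x => by
    rw [mul_smul_comm, smul_mul_assoc, ← smul_add, smul_apply, norm_smul, Complex.norm_I, one_mul]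
    exact hbound x
  rwa [norm_smul, Complex.norm_I, one_mul] at hnorm

end Regularized

/-! ### The commutator with the operator itself -/

section Commutator

variable [CompleteSpace X] {A W : X →ₗ.[ℂ] X} (hA : IsSelfAdjoint A) {c : ℝ}
variable (hW : IsSelfAdjoint W) (hWA : HasRelBoundedSqCommutator W A c) (hc : 0 ≤ c)
  (hN : ∀ᶠ t in 𝓝[>] 0, ∃ N, IsBoundedCommutator W (sqResolvent hA t) N)

include hW hWA hc hN

theorem HasRelBoundedSqCommutator.norm_weak_commutator_le_of_mem_domain_sq
    (hA_nonneg : ∀ f : A.domain, 0 ≤ (⟪(f : X), A f⟫_ℂ).re)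
    {f f' f₁ f₂ g g' g₁ g₂ : X}
    (hf : (f, f') ∈ W.graph) (hf₁ : (f, f₁) ∈ A.graph) (hf₂ : (f₁, f₂) ∈ A.graph)
    (hg : (g, g') ∈ W.graph) (hg₁ : (g, g₁) ∈ A.graph) (hg₂ : (g₁, g₂) ∈ A.graph) :
    ‖⟪g', f₁⟫_ℂ - ⟪g₁, f'⟫_ℂ‖ ≤ c / 2 * ‖g‖ * ‖f‖ := by
  set K := ‖g'‖ * (‖f‖ + 1) + (‖g‖ + 1) * ‖f'‖
  have happrox (η : ℝ) (hη : 0 < η) :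
      ‖⟪g', f₁⟫_ℂ - ⟪g₁, f'⟫_ℂ‖ ≤ c / 2 * ‖g‖ * ‖f‖ + η * K := by
    obtain ⟨t, ht, hηt, ⟨N, hN⟩, hBf, hBg⟩ :=
      (eventually_mem_nhdsWithin.and <| (eventually_mul_sq_le_one η).and <| hN.and <|
        (eventually_norm_regularizedAbs_sub_le hA hA_nonneg hη hf₁ hf₂).and
          (eventually_norm_regularizedAbs_sub_le hA hA_nonneg hη hg₁ hg₂)).exists
    obtain ⟨C, hC, hCnorm⟩ :=
      hWA.exists_isBoundedCommutator_regularizedAbs hA hW hc ht hη hηt hN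
    have hform := hC.norm_inner_sub_inner_le hW (isSelfAdjoint_regularizedAbs hA t η) hCnorm hf hg
    set B := regularizedAbs hA t η
    calc ‖⟪g', f₁⟫_ℂ - ⟪g₁, f'⟫_ℂ‖
        = ‖(⟪g', B f⟫_ℂ - ⟪B g, f'⟫_ℂ) - ⟪g', B f - f₁⟫_ℂ + ⟪B g - g₁, f'⟫_ℂ‖ := by
          rw [inner_sub_left, inner_sub_right]
          congr 1
          ring
      _ ≤ c / 2 * ‖g‖ * ‖f‖ + ‖g'‖ * (η * (‖f‖ + 1)) + η * (‖g‖ + 1) * ‖f'‖ := by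
          refine (norm_add_le _ _).trans (add_le_add ((norm_sub_le _ _).trans
            (add_le_add hform ?_)) ?_)
          · exact (norm_inner_le_norm _ _).trans (by gcongr)
          · exact (norm_inner_le_norm _ _).trans (by gcongr)
      _ = c / 2 * ‖g‖ * ‖f‖ + η * K := by ring
  have hlim : Tendsto (fun η => c / 2 * ‖g‖ * ‖f‖ + η * K) (𝓝[>] 0) (𝓝 (c / 2 * ‖g‖ * ‖f‖)) :=
    (Continuous.tendsto' (by fun_prop) _ _ (by simp)).mono_left nhdsWithin_le_nhds
  exact ge_of_tendsto hlim (eventually_mem_nhdsWithin.mono happrox)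

theorem HasRelBoundedSqCommutator.exists_tendsto_sqResolvent_mem_graph
    {f f' : X} (hf : (f, f') ∈ W.graph) :
    ∃ F : ℝ → X, Tendsto F (𝓝[>] 0) (𝓝 f') ∧ ∀ᶠ t in 𝓝[>] 0,
      (sqResolvent hA t f, F t) ∈ W.graph ∧ F t ∈ A.domain := by
  have hk : ∀ᶠ t in 𝓝[>] 0, ∃ k, ‖k‖ ≤ c * t * ‖f‖ ∧
      (sqResolvent hA t f, sqResolvent hA t (f' - k)) ∈ W.graph := by
    filter_upwards [eventually_mem_nhdsWithin, hN] with t ht ⟨N, hN⟩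
    obtain ⟨k, hk, hJf⟩ := hWA.exists_sqResolvent_mem_graph hA hW ht (fun _ => hN.mem_domain) hf
    have ht' : 0 ≤ c * t := mul_nonneg hc (le_of_lt ht)
    exact ⟨k, hk.trans (by gcongr; exact norm_mulSqResolvent_apply_le hA f), hJf⟩
  obtain ⟨k, hk⟩ := hk.choice
  refine ⟨fun t => sqResolvent hA t (f' - k t), ?_, ?_⟩
  · have hk0 : Tendsto (fun t => sqResolvent hA t (k t)) (𝓝[>] 0) (𝓝 0) := by
      refine squeeze_zero_norm' (a := fun t => c * t * ‖f‖)
        (hk.mono fun t ht => (norm_sqResolvent_apply_le hA _).trans ht.1) ?_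
      exact (Continuous.tendsto' (by fun_prop) _ _ (by simp)).mono_left nhdsWithin_le_nhds
    simpa only [map_sub, sub_zero] using
      ((tendsto_sqResolvent_apply hA f').mono_left nhdsWithin_le_nhds).sub hk0
  · filter_upwards [eventually_mem_nhdsWithin, hk] with t ht hkt
    exact ⟨hkt.2, mem_domain_of_mem_graph
      (inv_smul_mulSqResolvent_mem_graph hA (ne_of_gt ht) (f' - k t))⟩

theorem HasRelBoundedSqCommutator.norm_weak_commutator_le
    (hA_nonneg : ∀ f : A.domain, 0 ≤ (⟪(f : X), A f⟫_ℂ).re)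
    {f f' f₁ g g' g₁ : X}
    (hf : (f, f') ∈ W.graph) (hf₁ : (f, f₁) ∈ A.graph)
    (hg : (g, g') ∈ W.graph) (hg₁ : (g, g₁) ∈ A.graph) :
    ‖⟪g', f₁⟫_ℂ - ⟪g₁, f'⟫_ℂ‖ ≤ c / 2 * ‖g‖ * ‖f‖ := by
  obtain ⟨F, hF, hFW⟩ := hWA.exists_tendsto_sqResolvent_mem_graph hA hW hc hN hf
  obtain ⟨G, hG, hGW⟩ := hWA.exists_tendsto_sqResolvent_mem_graph hA hW hc hN hg
  have hJ (x : X) : Tendsto (fun t => sqResolvent hA t x) (𝓝[>] 0) (𝓝 x) :=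
    (tendsto_sqResolvent_apply hA x).mono_left nhdsWithin_le_nhds
  refine le_of_tendsto_of_tendsto ((hG.inner (hJ f₁)).sub ((hJ g₁).inner hF)).norm
    ((tendsto_const_nhds (x := c / 2)).mul (hJ g).norm |>.mul (hJ f).norm) ?_
  filter_upwards [eventually_mem_nhdsWithin, hFW, hGW] with t ht hFt hGt
  exact hWA.norm_weak_commutator_le_of_mem_domain_sq hA hW hc hN hA_nonneg
    hFt.1 (sqResolvent_mem_graph hA hf₁)
    (inv_smul_mulSqResolvent_mem_graph hA (ne_of_gt ht) f₁)
    hGt.1 (sqResolvent_mem_graph hA hg₁)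
    (inv_smul_mulSqResolvent_mem_graph hA (ne_of_gt ht) g₁)

theorem HasRelBoundedSqCommutator.dense_domain_inf :
    Dense ((W.domain ⊓ A.domain : Submodule ℂ X) : Set X) := by
  refine dense_of_eventually_sqResolvent_mem hA hW.dense_domain fun f hf => ?_
  obtain ⟨_, _, hF⟩ := hWA.exists_tendsto_sqResolvent_mem_graph hA hW hc hN (apply_mem_graph hf)
  filter_upwards [eventually_mem_nhdsWithin, hF] with t ht hFt
  exact ⟨mem_domain_of_mem_graph hFt.1,
    mem_domain_of_mem_graph (inv_smul_mulSqResolvent_mem_graph hA (ne_of_gt ht) f)⟩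

theorem HasRelBoundedSqCommutator.exists_isWeakCommutatorAt
    (hA_nonneg : ∀ f : A.domain, 0 ≤ (⟪(f : X), A f⟫_ℂ).re) :
    ∃ T : X →L[ℂ] X, ∀ f, f ∈ W.domain → f ∈ A.domain → IsWeakCommutatorAt W A f (T f) := by
  let D := W.domain ⊓ A.domain
  let ιW : D →ₗ[ℂ] X := W.toFun ∘ₗ D.inclusion inf_le_left
  let ιA : D →ₗ[ℂ] X := A.toFun ∘ₗ Submodule.inclusion inf_le_right
  obtain ⟨T, hT⟩ := exists_forall_inner_eq_of_bound (hWA.dense_domain_inf hA hW hc hN)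
    (((innerₛₗ ℂ).comp ιW).compl₂ ιA - ((innerₛₗ ℂ).comp ιA).compl₂ ιW) fun g f =>
      hWA.norm_weak_commutator_le hA hW hc hN hA_nonneg (apply_mem_graph f.2.1)
        (apply_mem_graph f.2.2) (apply_mem_graph g.2.1) (apply_mem_graph g.2.2)
  exact ⟨T, fun f hfW hfA => ⟨hfW, hfA, fun g hgW hgA => hT ⟨g, hgW, hgA⟩ ⟨f, hfW, hfA⟩⟩⟩

theorem HasRelBoundedSqCommutator.mem_graph_of_forall_inner {x y : X}
    (h : ∀ ⦃g g' g₁⦄, (g, g') ∈ W.graph → (g, g₁) ∈ A.graph → ⟪g', x⟫_ℂ = ⟪g, y⟫_ℂ) :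
    (x, y) ∈ W.graph := by
  refine (mem_graph_iff_forall_inner hW).2 fun g g' hg => ?_
  obtain ⟨G, hG, hGW⟩ := hWA.exists_tendsto_sqResolvent_mem_graph hA hW hc hN hg
  have hJ := (tendsto_sqResolvent_apply hA g).mono_left (nhdsWithin_le_nhds (s := Set.Ioi 0))
  refine tendsto_nhds_unique_of_eventuallyEq (hG.inner tendsto_const_nhds)
    (hJ.inner tendsto_const_nhds) ?_
  filter_upwards [eventually_mem_nhdsWithin, hGW] with t ht hGt
  exact h hGt.1 (inv_smul_mulSqResolvent_mem_graph hA (ne_of_gt ht) g)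

theorem HasRelBoundedSqCommutator.add_weak_commutator_mem_graph {f f' f₁ l h : X}
    (hf : (f, f') ∈ W.graph) (hf₁ : (f, f₁) ∈ A.graph) (hl : (f', l) ∈ A.graph)
    (hweak : IsWeakCommutatorAt W A f h) : (f₁, l + h) ∈ W.graph := by
  refine hWA.mem_graph_of_forall_inner hA hW hc hN fun g g' g₁ hg hg₁ => ?_
  rw [inner_add_right, (isWeakCommutatorAt_iff hf hf₁).1 hweak hg hg₁,
    inner_eq_inner_of_mem_graph hA hl hg₁, add_sub_cancel]

theorem HasRelBoundedSqCommutator.mem_graph_commutator {f f' h : X}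
    (hf : (f, f') ∈ W.graph) (hf' : f' ∈ A.domain)
    (hweak : IsWeakCommutatorAt W A f h) : (f, h) ∈ (commutator W A).graph := by
  have hfA := apply_mem_graph hweak.2.1
  have hl := apply_mem_graph hf'
  simpa using sub_mem_graph_commutator
    (mem_graph_mul_iff.2 ⟨_, hfA, hWA.add_weak_commutator_mem_graph hA hW hc hN hf hfA hl hweak⟩)
    (mem_graph_mul_iff.2 ⟨_, hf, hl⟩)

theorem HasRelBoundedSqCommutator.dense_domain_commutator {T : X → X}
    (hT : ∀ f, f ∈ W.domain → f ∈ A.domain → IsWeakCommutatorAt W A f (T f)) :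
    Dense ((commutator W A).domain : Set X) := by
  refine dense_of_eventually_sqResolvent_mem hA hW.dense_domain fun f hf => ?_
  obtain ⟨_, _, hF⟩ := hWA.exists_tendsto_sqResolvent_mem_graph hA hW hc hN (apply_mem_graph hf)
  filter_upwards [eventually_mem_nhdsWithin, hF] with t ht ⟨hFW, hFA⟩
  have hJA := mem_domain_of_mem_graph (inv_smul_mulSqResolvent_mem_graph hA (ne_of_gt ht) f)
  exact mem_domain_of_mem_graph (hWA.mem_graph_commutator hA hW hc hN hFW hFA
    (hT _ (mem_domain_of_mem_graph hFW) hJA))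

theorem HasRelBoundedSqCommutator.commutator_apply_eq {T : X → X}
    (hT : ∀ f, f ∈ W.domain → f ∈ A.domain → IsWeakCommutatorAt W A f (T f))
    (f : (commutator W A).domain) : commutator W A f = T f := by
  obtain ⟨hfA, -⟩ := mem_mul_domain.1 f.2.1
  obtain ⟨hfW, hWf⟩ := mem_mul_domain.1 f.2.2
  exact apply_eq_of_mem_graph
    (hWA.mem_graph_commutator hA hW hc hN (apply_mem_graph hfW) hWf (hT f hfW hfA)) f.2

end Commutator

end UnboundedOp

end

theorem mainTheorem5_general {X : Type*} [NormedAddCommGroup X] [InnerProductSpace ℂ X]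
    [CompleteSpace X] (L W : X →ₗ.[ℂ] X) (hL : IsSelfAdjoint L) (hW : IsSelfAdjoint W)
    (hL_nonneg : ∀ f : L.domain, 0 ≤ (⟪(f : X), L f⟫_ℂ).re)
    (hdom : ∃ r : ℝ, 0 < r ∧ ∀ f : (UnboundedOp.mul L L).domain,
      UnboundedOp.mul L L f + (r : ℂ) • (f : X) ∈ W.domain → (f : X) ∈ W.domain)
    (c : ℝ)
    (hc : ∀ (f : X) (_ : f ∈ W.domain) (_ : f ∈ (UnboundedOp.mul L L).domain)
      (hf : f ∈ L.domain),
      ∃ h : X, UnboundedOp.IsWeakCommutatorAt W (UnboundedOp.mul L L) f h ∧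
        ‖h‖ ≤ c * ‖L ⟨f, hf⟩‖) :
    Dense ((UnboundedOp.commutator W L).domain : Set X) ∧
    ∃ T : X →L[ℂ] X,
      (∀ f : (UnboundedOp.commutator W L).domain, UnboundedOp.commutator W L f = T f) ∧
      (∀ f : X, f ∈ W.domain → f ∈ L.domain → UnboundedOp.IsWeakCommutatorAt W L f (T f)) := by
  obtain ⟨r, hr, hres⟩ := hdom
  have hWL := UnboundedOp.HasRelBoundedSqCommutator.of_isWeakCommutatorAt hc
  have hc' := abs_nonneg c
  have hJ := hWL.eventually_exists_isBoundedCommutator hL hW hc' (inv_pos.2 (Real.sqrt_pos.2 hr))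
    fun _ => UnboundedOp.sqResolvent_mem_domain_of_resolvent_invariant hL hr hres
  obtain ⟨T, hT⟩ := hWL.exists_isWeakCommutatorAt hL hW hc' hJ hL_nonneg
  exact ⟨hWL.dense_domain_commutator hL hW hc' hJ hT, T,
    hWL.commutator_apply_eq hL hW hc' hJ hT, hT⟩

theorem mainTheorem5 {X : Type*} [NormedAddCommGroup X] [InnerProductSpace ℂ X] [CompleteSpace X]
    (L W : X →ₗ.[ℂ] X) (hL : IsSelfAdjoint L) (hW : IsSelfAdjoint W)
    (hL_nonneg : ∀ f : L.domain, 0 ≤ (⟪(f : X), L f⟫_ℂ).re)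
    (hL_null : ∀ f : L.domain, L f = 0 → f = 0)
    -- some resolvent of the square of `L` leaves the domain of `W` invariant
    (hdom : ∃ r : ℝ, 0 < r ∧ ∀ f : (UnboundedOp.mul L L).domain,
      UnboundedOp.mul L L f + (r : ℂ) • (f : X) ∈ W.domain → (f : X) ∈ W.domain)
    (c : ℝ)
    (hc : ∀ (f : X) (_ : f ∈ W.domain) (_ : f ∈ (UnboundedOp.mul L L).domain)
      (hf : f ∈ L.domain),
      ∃ h : X, UnboundedOp.IsWeakCommutatorAt W (UnboundedOp.mul L L) f h ∧
        ‖h‖ ≤ c * ‖L ⟨f, hf⟩‖) :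
    Dense ((UnboundedOp.commutator W L).domain : Set X) ∧
    ∃ T : X →L[ℂ] X,
      (∀ f : (UnboundedOp.commutator W L).domain, UnboundedOp.commutator W L f = T f) ∧
      (∀ f : X, f ∈ W.domain → f ∈ L.domain → UnboundedOp.IsWeakCommutatorAt W L f (T f)) :=
  mainTheorem5_general L W hL hW hL_nonneg hdom c hc
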